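/- Let $\phi=(1+\sqrt5)/2$, let $\|X\|_1=\operatorname{Tr}\,(X^*X)^{1/2}$ be the trace norm and $[X,Y]=XY-YX$. Let $A$ be any complex $n\times n$ matrix and let $C$ be a positive semidefinite complex $n\times n$ matrix with $\operatorname{Tr} C=1$. Then $$\|[A,\log C]\|_1\;\le\;\phi\,\|[A,\log C-\log(I-C)]\|_1 .$$ If $C$ is positive definite, both sides are the usual finite quantities (if $n=1$, where $I-C=0$, both commutators are $0$). In general the two sides are elements of $[0,\infty]$, understood with $\log 0=-\infty$, as follows. For a function $f:[0,1]\to[-\infty,\infty]$, put $\|[A,f(C)]\|_1=\infty$ unless $A$ commutes with the spectral projections of $C$ onto $\{f=-\infty\}$ and onto $\{f=+\infty\}$; if $A$ commutes with both, put $\|[A,f(C)]\|_1=\|[A,\tilde f(C)]\|_1$, where $\tilde f=f$ where $f$ is finite and $\tilde f=0$ elsewhere. The left side is the case $f(x)=\log x$, the right side the case $f(x)=\log x-\log(1-x)$. -/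

import Mathlib

open scoped ENNReal Matrix ComplexOrder

noncomputable section

/-- The trace norm (Schatten 1-norm) `‖X‖₁ = Tr (X* X)^{1/2}` of a complex square matrix. -/
def traceNorm {n : ℕ} (X : Matrix (Fin n) (Fin n) ℂ) : ℝ :=
  (Matrix.trace (cfc Real.sqrt (Xᴴ * X))).re

/-- The logarithm of a Hermitian matrix, through the functional calculus. It is the usual
logarithm whenever the matrix is positive definite. -/
def matrixLog {n : ℕ} (C : Matrix (Fin n) (Fin n) ℂ) : Matrix (Fin n) (Fin n) ℂ :=
  cfc Real.log C

/-- The spectral projection of a Hermitian matrix `C` onto the sum of its eigenspaces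
for the eigenvalues in `S`. -/
def spectralProj {n : ℕ} (C : Matrix (Fin n) (Fin n) ℂ) (S : Set ℝ) :
    Matrix (Fin n) (Fin n) ℂ :=
  cfc (S.indicator (fun _ => (1 : ℝ))) C

open Classical in
/-- The trace norm `‖[A, f(C)]‖₁ ∈ [0, ∞]` for a Hermitian matrix `C` and an extended-real valued
function `f`. In an eigenbasis of `C` the entries of `[A, f(C)]` are `A i j * (f (c j) - f (c i))`.
If `A` has a nonzero entry between two eigenvectors one of which has an infinite value of `f` that
the other one does not share, that is, if `A` does not commute with both of the spectral projections
of `C` for `f = -∞` and for `f = +∞`, then the norm is infinite. Otherwise `A` is block diagonal,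
`f(C)` is a multiple of the identity on the blocks where `f` is infinite, so that the commutator
vanishes there, and what remains is the commutator with the finite part of `f(C)`
(`EReal.toReal` is `0` at `±∞`). -/
def commTraceNorm {n : ℕ} (A : Matrix (Fin n) (Fin n) ℂ) (f : ℝ → EReal)
    (C : Matrix (Fin n) (Fin n) ℂ) : ℝ≥0∞ :=
  if Commute A (spectralProj C {x | f x = ⊥}) ∧ Commute A (spectralProj C {x | f x = ⊤}) then
    ENNReal.ofReal (traceNorm ⁅A, cfc (fun x => (f x).toReal) C⁆)
  else ⊤

/-- The logarithm on `[0, ∞)` with `log 0 = -∞`. -/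
def extLog (x : ℝ) : EReal := ENNReal.log (ENNReal.ofReal x)

/-- The function `log x - log (1 - x)` on `[0, 1]`, with value `-∞` at `0` and `+∞` at `1`. -/
def extLogit (x : ℝ) : EReal := extLog x - extLog (1 - x)

end

/-! In an eigenbasis of `C`, with eigenvalues `c i`, the left commutator is the Schur product of the
right one with the multiplier `(log c j - log c i) / (logit c j - logit c i)`. Writing `c = 1 / (1 +
exp y)`, this multiplier is `1 - logisticMean (y i) (y j)`.

A Schur multiplier is bounded by `α` in trace norm once it is the off-diagonal block of a positive
semidefinite matrix with diagonal at most `α` (`traceNorm_hadamard_le`). Commutators with functions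
of `C` have zero diagonal in this basis, so diagonal entries of the multiplier may be changed
freely.

Since `Tr C = 1`, every eigenvalue but the largest, `c i₀`, is at most `e = min (1 - c i₀) (1/2)`.
On the small eigenvalues the logistic mean has a completion by Cauchy kernels with diagonal at most
`√(e / (1 - e)) / 2` (`exists_logisticMean_completion`). The row and column of `i₀` are fitted by
rank-one terms, their common diagonal entry being left free (`exists_multiplier_completion`). The
resulting diagonal is at most `25/16`, which is below the golden ratio.

Zero eigenvalues do no harm: a finite right side makes `A` block diagonal with respect to the kernel
of `C`. -/

namespace Matrix

/-! ### Trace norm through positive semidefinite block matrices -/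

section TraceNorm

variable {n : ℕ}

theorem cfc_mul_cfc (N : Matrix (Fin n) (Fin n) ℂ) (f g : ℝ → ℝ) :
    cfc f N * cfc g N = cfc (fun x => f x * g x) N :=
  (cfc_mul f g N (N.finite_real_spectrum.continuousOn _)
    (N.finite_real_spectrum.continuousOn _)).symm

theorem conjTranspose_cfc (N : Matrix (Fin n) (Fin n) ℂ) (f : ℝ → ℝ) :
    (cfc f N)ᴴ = cfc f N :=
  cfc_predicate (p := IsSelfAdjoint) f N

theorem cfc_id_of_isHermitian {N : Matrix (Fin n) (Fin n) ℂ} (hN : N.IsHermitian) :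
    cfc (fun x : ℝ => x) N = N :=
  cfc_id' ℝ N hN

theorem PosSemidef.of_fromBlocks_left {P X Y Q : Matrix (Fin n) (Fin n) ℂ}
    (h : (fromBlocks P X Y Q).PosSemidef) : P.PosSemidef :=
  h.submatrix (Sum.inl : Fin n → Fin n ⊕ Fin n)

theorem PosSemidef.of_fromBlocks_right {P X Y Q : Matrix (Fin n) (Fin n) ℂ}
    (h : (fromBlocks P X Y Q).PosSemidef) : Q.PosSemidef :=
  h.submatrix (Sum.inr : Fin n → Fin n ⊕ Fin n)

/-- The trace norm is at most the half trace of any positive semidefinite block completion. -/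
theorem two_mul_traceNorm_le {P X Q : Matrix (Fin n) (Fin n) ℂ}
    (h : (fromBlocks P X Xᴴ Q).PosSemidef) :
    2 * traceNorm X ≤ P.trace.re + Q.trace.re := by
  have hN : (Xᴴ * X).IsHermitian := isHermitian_conjTranspose_mul_self X
  set N := Xᴴ * X with hNdef
  set T := cfc Real.sqrt N with hT
  -- Because `0⁻¹ = 0`, `H` is the pseudo-inverse of `|X|`, and `X * H` is the partial isometry of
  -- the polar decomposition.
  set H := cfc (fun x : ℝ => (√x)⁻¹) N with hH
  have hHH : Hᴴ = H := conjTranspose_cfc _ _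
  have hHN : H * N = T := by
    conv_lhs => rw [← cfc_id_of_isHermitian hN]
    rw [hH, cfc_mul_cfc, hT]
    congr 1; ext x; rw [mul_comm, ← div_eq_mul_inv, Real.div_sqrt]
  have hNH : N * H = T := by
    conv_lhs => rw [← cfc_id_of_isHermitian hN]
    rw [hH, cfc_mul_cfc, hT]
    congr 1; ext x; rw [← div_eq_mul_inv, Real.div_sqrt]
  have hHTH : H * T * H = H := by
    rw [hH, hT, cfc_mul_cfc, cfc_mul_cfc]
    congr 1; ext x
    by_cases hx : √x = 0
    · simp [hx]
    · field_simp
  set U := X * H with hU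
  have hUX : Uᴴ * X = T := by rw [hU, conjTranspose_mul, hHH, Matrix.mul_assoc, ← hNdef, hHN]
  have hXU : Xᴴ * U = T := by rw [hU, ← Matrix.mul_assoc, ← hNdef, hNH]
  have hE : (U * Uᴴ) * (U * Uᴴ) = U * Uᴴ := by
    calc (U * Uᴴ) * (U * Uᴴ) = X * (H * (Uᴴ * X) * H) * Uᴴ := by
          rw [hU]; simp only [Matrix.mul_assoc]
      _ = U * Uᴴ := by rw [hUX, hHTH]
  -- Compressing by the column `(-U, 1)` gives `2 Tr |X| ≤ Tr (U* P U) + Tr Q`; as `U U*` is a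
  -- projection, `Tr (U* P U) ≤ Tr P`.
  have h1 := (h.conjTranspose_mul_mul_same
    (fromRows (-U) (1 : Matrix (Fin n) (Fin n) ℂ))).trace_nonneg
  have h1' : (fromRows (-U) (1 : Matrix (Fin n) (Fin n) ℂ))ᴴ * fromBlocks P X Xᴴ Q *
      fromRows (-U) (1 : Matrix (Fin n) (Fin n) ℂ)
      = Uᴴ * P * U - T - T + Q := by
    rw [conjTranspose_fromRows_eq_fromCols_conjTranspose, fromCols_mul_fromBlocks,
      fromCols_mul_fromRows]
    simp only [conjTranspose_neg, conjTranspose_one, Matrix.neg_mul, Matrix.mul_neg,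
      Matrix.one_mul, Matrix.mul_one, Matrix.add_mul, hUX, hXU]
    abel
  rw [h1'] at h1
  have h2 := (h.of_fromBlocks_left.conjTranspose_mul_mul_same (1 - U * Uᴴ)).trace_nonneg
  have h2' : ((1 - U * Uᴴ)ᴴ * P * (1 - U * Uᴴ)).trace = P.trace - (Uᴴ * P * U).trace := by
    have : (1 - U * Uᴴ) * (1 - U * Uᴴ)ᴴ = 1 - U * Uᴴ := by
      simp only [conjTranspose_sub, conjTranspose_one, conjTranspose_mul,
        conjTranspose_conjTranspose, Matrix.sub_mul, Matrix.mul_sub, Matrix.one_mul,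
        Matrix.mul_one, hE]
      abel
    rw [trace_mul_comm, ← Matrix.mul_assoc, this, Matrix.sub_mul, trace_sub, Matrix.one_mul,
      Matrix.mul_assoc, trace_mul_comm U]
  rw [h2'] at h2
  simp only [trace_add, trace_sub] at h1
  have h1r := (Complex.le_def.1 h1).1
  have h2r := (Complex.le_def.1 h2).1
  simp only [Complex.zero_re, Complex.add_re, Complex.sub_re] at h1r h2r
  have : traceNorm X = T.trace.re := rfl
  linarith

/-- The bound `two_mul_traceNorm_le` is attained: multiply the column `(X |X|^(-1/2), |X|^(1/2))` by
its adjoint, with a pseudo-inverse power. Together the two lemmas give a variational formula for the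
trace norm. -/
theorem exists_posSemidef_fromBlocks (X : Matrix (Fin n) (Fin n) ℂ) :
    ∃ P Q : Matrix (Fin n) (Fin n) ℂ, (fromBlocks P X Xᴴ Q).PosSemidef ∧
      P.trace.re = traceNorm X ∧ Q.trace.re = traceNorm X := by
  have hN : (Xᴴ * X).IsHermitian := isHermitian_conjTranspose_mul_self X
  have hpos := posSemidef_conjTranspose_mul_self X
  set N := Xᴴ * X with hNdef
  have hsp : ∀ x ∈ spectrum ℝ N, 0 ≤ x := fun x hx => by
    have := (posSemidef_iff_isHermitian_and_spectrum_nonneg.1 hpos).2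
      ((spectrum.algebraMap_mem_iff ℂ).2 hx)
    simpa using this
  set T := cfc Real.sqrt N with hT
  set G := cfc (fun x : ℝ => (√(√x))⁻¹) N with hG
  set D := cfc (fun x : ℝ => √(√x)) N with hD
  set p := cfc (fun x : ℝ => (√(√x))⁻¹ * √(√x)) N with hp
  have hGG : Gᴴ = G := conjTranspose_cfc _ _
  have hDD : Dᴴ = D := conjTranspose_cfc _ _
  have hGD : G * D = p := cfc_mul_cfc _ _ _
  have hpp : pᴴ = p := conjTranspose_cfc _ _
  have hNp : N * p = N := by
    conv_lhs => rw [← cfc_id_of_isHermitian hN]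
    rw [hp, cfc_mul_cfc]
    conv_rhs => rw [← cfc_id_of_isHermitian hN]
    apply cfc_congr
    intro x hx
    rcases (hsp x hx).eq_or_lt with h | h
    · simp [← h]
    · have : √(√x) ≠ 0 := by positivity
      simp [this]
  -- `p` is the support projection of `|X|`; the difference `X * p - X` vanishes because its Gram
  -- matrix does.
  have hXp : X * p = X := by
    rw [← sub_eq_zero, ← trace_conjTranspose_mul_self_eq_zero_iff]
    have : (X * p - X)ᴴ * (X * p - X) = 0 := by
      simp only [conjTranspose_sub, conjTranspose_mul, hpp, Matrix.sub_mul, Matrix.mul_sub]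
      simp only [Matrix.mul_assoc, ← Matrix.mul_assoc Xᴴ X, ← hNdef, hNp]
      simp
    rw [this, trace_zero]
  have hDT : D * D = T := by
    rw [hD, cfc_mul_cfc, hT]
    congr 1; ext x; exact Real.mul_self_sqrt (Real.sqrt_nonneg x)
  have hGT : G * N * G = T := by
    conv_lhs => rw [← cfc_id_of_isHermitian hN]
    rw [hG, cfc_mul_cfc, cfc_mul_cfc, hT]
    congr 1; ext x
    calc (√(√x))⁻¹ * x * (√(√x))⁻¹ = x / (√(√x) * √(√x)) := by
          rw [div_eq_mul_inv, mul_inv]; ring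
      _ = √x := by rw [Real.mul_self_sqrt (Real.sqrt_nonneg x), Real.div_sqrt]
  refine ⟨X * G * (X * G)ᴴ, D * Dᴴ, ?_, ?_, ?_⟩
  · have h := posSemidef_self_mul_conjTranspose (fromRows (X * G) D)
    rw [conjTranspose_fromRows_eq_fromCols_conjTranspose, fromRows_mul_fromCols] at h
    have e1 : X * G * Dᴴ = X := by rw [hDD, Matrix.mul_assoc, hGD, hXp]
    have e2 : D * (X * G)ᴴ = Xᴴ := by
      conv_rhs => rw [← e1]
      simp
    rwa [e1, e2] at h
  · rw [trace_mul_comm, conjTranspose_mul, hGG, Matrix.mul_assoc, ← Matrix.mul_assoc Xᴴ, ← hNdef,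
      ← Matrix.mul_assoc, hGT]
    rfl
  · rw [hDD, hDT]; rfl

theorem traceNorm_nonneg (X : Matrix (Fin n) (Fin n) ℂ) : 0 ≤ traceNorm X := by
  obtain ⟨P, Q, h, hP, -⟩ := exists_posSemidef_fromBlocks X
  rw [← hP]
  exact (Complex.le_def.1 h.of_fromBlocks_left.trace_nonneg).1

theorem traceNorm_zero : traceNorm (0 : Matrix (Fin n) (Fin n) ℂ) = 0 := by
  refine le_antisymm ?_ (traceNorm_nonneg _)
  have := two_mul_traceNorm_le (n := n) (P := 0) (X := 0) (Q := 0)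
    (by rw [conjTranspose_zero, fromBlocks_zero]; exact .zero)
  simp only [trace_zero, Complex.zero_re] at this
  linarith

theorem traceNorm_conj_le {U : Matrix (Fin n) (Fin n) ℂ} (hU : Uᴴ * U = 1)
    (X : Matrix (Fin n) (Fin n) ℂ) : traceNorm (U * X * Uᴴ) ≤ traceNorm X := by
  obtain ⟨P, Q, h, hP, hQ⟩ := exists_posSemidef_fromBlocks X
  have h1 := h.mul_mul_conjTranspose_same (fromBlocks U 0 0 U)
  simp only [fromBlocks_conjTranspose, fromBlocks_multiply, conjTranspose_zero, Matrix.zero_mul,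
    Matrix.mul_zero, add_zero, zero_add] at h1
  have e : U * Xᴴ * Uᴴ = (U * X * Uᴴ)ᴴ := by simp [Matrix.mul_assoc]
  rw [e] at h1
  have ht : ∀ Y : Matrix (Fin n) (Fin n) ℂ, (U * Y * Uᴴ).trace = Y.trace := fun Y => by
    rw [trace_mul_comm, ← Matrix.mul_assoc, hU, Matrix.one_mul]
  have h2 := two_mul_traceNorm_le h1
  rw [ht, ht, hP, hQ] at h2
  linarith

theorem traceNorm_conj {U : Matrix (Fin n) (Fin n) ℂ} (hU : Uᴴ * U = 1)
    (X : Matrix (Fin n) (Fin n) ℂ) : traceNorm (U * X * Uᴴ) = traceNorm X := by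
  refine le_antisymm (traceNorm_conj_le hU X) ?_
  have hU' : Uᴴᴴ * Uᴴ = 1 := by
    rw [conjTranspose_conjTranspose]; exact mul_eq_one_comm.1 hU
  have h := traceNorm_conj_le hU' (U * X * Uᴴ)
  have e : Uᴴ * (U * X * Uᴴ) * Uᴴᴴ = Uᴴ * U * X * (Uᴴ * U) := by
    simp only [conjTranspose_conjTranspose, Matrix.mul_assoc]
  rwa [e, hU, Matrix.one_mul, Matrix.mul_one] at h

/-- Schur multipliers with a positive semidefinite block completion whose diagonal is bounded by
`α` have norm at most `α` with respect to the trace norm. -/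
theorem traceNorm_hadamard_le {P M Q : Matrix (Fin n) (Fin n) ℂ} {α : ℝ}
    (h : (fromBlocks P M Mᴴ Q).PosSemidef) (hP : ∀ i, P i i ≤ α) (hQ : ∀ i, Q i i ≤ α)
    (X : Matrix (Fin n) (Fin n) ℂ) : traceNorm (M ⊙ X) ≤ α * traceNorm X := by
  obtain ⟨P', Q', h', hP', hQ'⟩ := exists_posSemidef_fromBlocks X
  -- Schur product theorem: the entrywise product of the two completions completes `M ⊙ X`.
  have h1 := h.hadamard h'
  have e : fromBlocks P M Mᴴ Q ⊙ fromBlocks P' X Xᴴ Q'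
      = fromBlocks (P ⊙ P') (M ⊙ X) (M ⊙ X)ᴴ (Q ⊙ Q') := by
    ext (i | i) (j | j) <;> simp
  rw [e] at h1
  have key : ∀ {A A' : Matrix (Fin n) (Fin n) ℂ}, (∀ i, A i i ≤ α) → A'.PosSemidef →
      (A ⊙ A').trace.re ≤ α * A'.trace.re := by
    intro A A' hA hA'
    have : (A ⊙ A').trace ≤ (α : ℂ) * A'.trace := by
      simp only [trace, diag_apply, hadamard_apply, Finset.mul_sum]
      exact Finset.sum_le_sum fun i _ => mul_le_mul_of_nonneg_right (hA i) hA'.diag_nonneg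
    simpa using (Complex.le_def.1 this).1
  have h2 := two_mul_traceNorm_le h1
  have k1 := key hP h'.of_fromBlocks_left
  have k2 := key hQ h'.of_fromBlocks_right
  rw [hP'] at k1
  rw [hQ'] at k2
  linarith

end TraceNorm

end Matrix

namespace Matrix

open MeasureTheory Real

/-! ### Positive semidefinite kernels from integrals -/

section Kernels

variable {ι : Type*} [Fintype ι]

theorem posSemidef_ofReal_mul (w : ι → ℝ) :
    (of fun a b => ((w a * w b : ℝ) : ℂ)).PosSemidef := by
  have h := posSemidef_vecMulVec_self_star (fun a => (w a : ℂ))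
  convert h using 1
  ext a b
  simp [vecMulVec_apply]

theorem posSemidef_ofReal_integral {α : Type*} [MeasurableSpace α] {μ : Measure α}
    {G : α → ι → ι → ℝ} (hint : ∀ a b, Integrable (fun t => G t a b) μ)
    (hG : ∀ᵐ t ∂μ, (of fun a b => (G t a b : ℂ)).PosSemidef) :
    (of fun a b => ((∫ t, G t a b ∂μ : ℝ) : ℂ)).PosSemidef := by
  refine .of_dotProduct_mulVec_nonneg ?_ fun x => ?_
  · ext a b
    simp only [conjTranspose_apply, of_apply, RCLike.star_def, Complex.conj_ofReal]
    congr 1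
    refine integral_congr_ae ?_
    filter_upwards [hG] with t ht
    have := congrFun (congrFun ht.1 a) b
    simpa using this
  · set F : α → ℂ := fun t => star x ⬝ᵥ ((of fun a b => (G t a b : ℂ)) *ᵥ x) with hF
    have hFe : ∀ t, F t = ∑ a, ∑ b, star (x a) * x b * (G t a b : ℂ) := by
      intro t
      simp only [hF, dotProduct, mulVec, of_apply, Finset.mul_sum, Pi.star_apply]
      refine Finset.sum_congr rfl fun a _ => Finset.sum_congr rfl fun b _ => ?_
      ring
    have hI : ∀ a b, Integrable (fun t => star (x a) * x b * (G t a b : ℂ)) μ := fun a b =>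
      (hint a b).ofReal.const_mul _
    have h1 : star x ⬝ᵥ ((of fun a b => ((∫ t, G t a b ∂μ : ℝ) : ℂ)) *ᵥ x) = ∫ t, F t ∂μ := by
      simp_rw [hFe]
      rw [integral_finsetSum _ fun a _ => integrable_finsetSum _ fun b _ => hI a b]
      simp only [dotProduct, mulVec, of_apply, Finset.mul_sum, Pi.star_apply]
      refine Finset.sum_congr rfl fun a _ => ?_
      rw [integral_finsetSum _ fun b _ => hI a b]
      refine Finset.sum_congr rfl fun b _ => ?_
      rw [integral_const_mul, integral_complex_ofReal]
      ring
    have hpos : ∀ᵐ t ∂μ, 0 ≤ F t := by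
      filter_upwards [hG] with t ht using ht.dotProduct_mulVec_nonneg x
    have h2 : ∫ t, F t ∂μ = ((∫ t, (F t).re ∂μ : ℝ) : ℂ) := by
      rw [← integral_complex_ofReal]
      refine integral_congr_ae ?_
      filter_upwards [hpos] with t ht
      exact (Complex.eq_re_of_ofReal_le (r := 0) (by simpa using ht))
    rw [h1, h2]
    refine Complex.zero_le_real.2 (integral_nonneg_of_ae ?_)
    filter_upwards [hpos] with t ht using (Complex.le_def.1 ht).1

/-- Weighted Cauchy kernels are positive semidefinite. -/
theorem posSemidef_ofReal_cauchy (k z : ι → ℝ) (hz : ∀ a, 0 < z a) :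
    (of fun a b => ((k a * k b / (z a + z b) : ℝ) : ℂ)).PosSemidef := by
  have hi : ∀ a b, ∀ t : ℝ, k a * exp (-z a * t) * (k b * exp (-z b * t))
      = k a * k b * exp (-(z a + z b) * t) := fun a b t => by
    rw [show -(z a + z b) * t = -z a * t + -z b * t by ring, exp_add]; ring
  -- `1 / (z a + z b)` is the integral over `t > 0` of the rank-one kernels `exp (-z a * t) * exp
  -- (-z b * t)`.
  have h := posSemidef_ofReal_integral (μ := volume.restrict (Set.Ioi (0 : ℝ)))
    (G := fun t a b => k a * exp (-z a * t) * (k b * exp (-z b * t)))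
    (fun a b => by
      simp_rw [hi]
      exact (integrableOn_exp_mul_Ioi (by linarith [hz a, hz b]) 0).const_mul _)
    (.of_forall fun t => posSemidef_ofReal_mul _)
  convert h using 1
  ext a b
  simp_rw [of_apply, hi]
  rw [integral_const_mul, integral_exp_mul_Ioi (by linarith [hz a, hz b])]
  have := (add_pos (hz a) (hz b)).ne'
  congr 1
  rw [mul_zero, exp_zero, neg_div_neg_eq, div_eq_mul_one_div]

end Kernels

/-! ### The logistic mean as a divided difference -/

section LogisticMean

/-- The mean of the decreasing logistic function `x ↦ 1 / (1 + exp x)` over a segment. -/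
noncomputable def logisticMean (x y : ℝ) : ℝ :=
  ∫ s in (0 : ℝ)..1, (1 + exp (s * x + (1 - s) * y))⁻¹

theorem continuous_logistic_segment (x y : ℝ) :
    Continuous fun s : ℝ => (1 + exp (s * x + (1 - s) * y))⁻¹ :=
  Continuous.inv₀ (by fun_prop) fun s => by positivity

theorem logisticMean_comm (x y : ℝ) : logisticMean x y = logisticMean y x := by
  have h := intervalIntegral.integral_comp_sub_left (a := 0) (b := 1)
    (fun s : ℝ => (1 + exp (s * y + (1 - s) * x))⁻¹) 1
  simp only [sub_self, sub_zero, sub_sub_cancel] at h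
  rw [logisticMean, logisticMean, ← h]
  congr 1; ext s; rw [add_comm (s * x)]

theorem logisticMean_nonneg (x y : ℝ) : 0 ≤ logisticMean x y :=
  intervalIntegral.integral_nonneg zero_le_one fun s _ => by positivity

theorem logisticMean_le {x y b : ℝ} (hx : (1 + exp x)⁻¹ ≤ b) (hy : (1 + exp y)⁻¹ ≤ b) :
    logisticMean x y ≤ b := by
  have h := intervalIntegral.integral_mono_on (μ := volume) zero_le_one
    ((continuous_logistic_segment x y).intervalIntegrable 0 1)
    (intervalIntegrable_const (c := b)) (fun s hs => ?_)
  · simpa [logisticMean] using h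
  · rcases le_total x y with hxy | hxy
    · refine le_trans (inv_anti₀ (by positivity) ?_) hx
      gcongr
      nlinarith [hs.1, hs.2]
    · refine le_trans (inv_anti₀ (by positivity) ?_) hy
      gcongr
      nlinarith [hs.1, hs.2]

/-- `-log (1 + exp (-x))` is an antiderivative of the logistic function. The product form also
covers `x = y`. -/
theorem sub_mul_logisticMean (x y : ℝ) :
    (x - y) * logisticMean x y = log (1 + exp (-y)) - log (1 + exp (-x)) := by
  rw [logisticMean, ← intervalIntegral.integral_const_mul]
  have h := intervalIntegral.integral_eq_sub_of_hasDerivAt (a := 0) (b := 1)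
    (f := fun s : ℝ => -log (1 + exp (-(s * x + (1 - s) * y))))
    (f' := fun s : ℝ => (x - y) * (1 + exp (s * x + (1 - s) * y))⁻¹) (fun s _ => ?_)
    (((continuous_logistic_segment x y).const_mul _).intervalIntegrable 0 1)
  · rw [h]; simp; ring
  · have h1 : HasDerivAt (fun s : ℝ => -(s * x + (1 - s) * y)) (-(1 * x + (-1) * y)) s :=
      (((hasDerivAt_id s).mul_const x).add
        (((hasDerivAt_id s).const_sub 1).mul_const y)).neg
    have h2 := ((h1.exp.const_add 1).log (by positivity)).neg
    refine h2.congr_deriv ?_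
    rw [Real.exp_neg]
    have := exp_pos (s * x + (1 - s) * y)
    field_simp
    ring

end LogisticMean

end Matrix

namespace Matrix

open MeasureTheory Real

/-! ### Completing the logistic mean -/

section LogisticKernel

variable {ι : Type*} [Fintype ι]

/-- A positive semidefinite block completion of the kernel `-logisticMean (y i) (y j)`, cut off by
the weights `χ`. -/
theorem exists_logisticMean_completion (y χ : ι → ℝ) (y₀ : ℝ) (hχ : ∀ i, χ i = 0 ∨ χ i = 1)
    (hy : ∀ i, χ i = 1 → y₀ ≤ y i) :
    ∃ K : ι ⊕ ι → ι ⊕ ι → ℝ, (of fun a b => (K a b : ℂ)).PosSemidef ∧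
      (∀ i j, K (.inl i) (.inr j) = -(χ i * χ j * logisticMean (y i) (y j))) ∧
      (∀ i, K (.inl i) (.inl i) ≤ χ i * (exp (-y₀ / 2) / 2)) ∧
      (∀ i, K (.inr i) (.inr i) ≤ χ i * (exp (-y₀ / 2) / 2)) := by
  -- For each `s` the Cauchy kernel of `k` and `z` has off-diagonal block minus the integrand of the
  -- logistic mean, cut off by `χ`. The opposite factors `exp (±(s - 1/2) y₀ / 2)` cancel there and
  -- balance the two diagonals, giving both the bound `exp (-y₀ / 2) / 2` for every `s`.
  set k : ℝ → ι ⊕ ι → ℝ := fun s => Sum.elim (fun i => χ i * exp ((s - 1 / 2) * y₀ / 2))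
    (fun j => -(χ j * exp (-((1 - s) * y j) - (s - 1 / 2) * y₀ / 2))) with hk
  set z : ℝ → ι ⊕ ι → ℝ := fun s => Sum.elim (fun i => exp (s * y i))
    (fun j => exp (-((1 - s) * y j))) with hz
  have hzpos : ∀ s a, 0 < z s a := by
    rintro s (i | i) <;> exact exp_pos _
  have hkc : ∀ a, Continuous fun s => k s a := by
    rintro (i | i) <;> simp only [hk, Sum.elim_inl, Sum.elim_inr] <;> fun_prop
  have hzc : ∀ a, Continuous fun s => z s a := by
    rintro (i | i) <;> simp only [hz, Sum.elim_inl, Sum.elim_inr] <;> fun_prop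
  have hGc : ∀ a b, Continuous fun s => k s a * k s b / (z s a + z s b) := fun a b =>
    ((hkc a).mul (hkc b)).div ((hzc a).add (hzc b)) fun s => (add_pos (hzpos s a) (hzpos s b)).ne'
  have hdiag : ∀ a, ∀ c : ℝ, (∀ s ∈ Set.Icc (0 : ℝ) 1, k s a * k s a / (z s a + z s a) ≤ c) →
      ∫ s in Set.Ioc (0 : ℝ) 1, k s a * k s a / (z s a + z s a) ≤ c := by
    intro a c hc
    rw [← intervalIntegral.integral_of_le zero_le_one]
    have h := intervalIntegral.integral_mono_on (μ := volume) zero_le_one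
      ((hGc a a).intervalIntegrable 0 1) (intervalIntegrable_const (c := c)) hc
    simpa using h
  refine ⟨fun a b => ∫ s in Set.Ioc (0 : ℝ) 1, k s a * k s b / (z s a + z s b), ?_, ?_, ?_, ?_⟩
  · exact posSemidef_ofReal_integral (G := fun s a b => k s a * k s b / (z s a + z s b))
      (fun a b => (hGc a b).integrableOn_Ioc)
      (.of_forall fun s => posSemidef_ofReal_cauchy _ _ (hzpos s))
  · intro i j
    beta_reduce
    rw [← intervalIntegral.integral_of_le zero_le_one, logisticMean,
      ← intervalIntegral.integral_const_mul, ← intervalIntegral.integral_neg]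
    congr 1; ext s
    simp only [hk, hz, Sum.elim_inl, Sum.elim_inr]
    have e1 : exp ((s - 1 / 2) * y₀ / 2) * exp (-((1 - s) * y j) - (s - 1 / 2) * y₀ / 2)
        = exp (-((1 - s) * y j)) := by rw [← exp_add]; congr 1; ring
    have e2 : exp (s * y i) = exp (s * y i + (1 - s) * y j) * exp (-((1 - s) * y j)) := by
      rw [← exp_add]; congr 1; ring
    calc _ = -(χ i * χ j * (exp ((s - 1 / 2) * y₀ / 2) *
            exp (-((1 - s) * y j) - (s - 1 / 2) * y₀ / 2)) /
            (exp (s * y i) + exp (-((1 - s) * y j)))) := by ring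
      _ = _ := by
        rw [e1, e2]
        have := exp_pos (s * y i + (1 - s) * y j)
        have := exp_pos (-((1 - s) * y j))
        field_simp
        ring
  · intro i
    refine hdiag _ _ fun s hs => ?_
    simp only [hk, hz, Sum.elim_inl]
    rcases hχ i with h | h
    · simp [h]
    · have hle := hy i h
      have e1 : exp ((s - 1 / 2) * y₀ / 2) * exp ((s - 1 / 2) * y₀ / 2)
          = exp ((s - 1 / 2) * y₀) := by rw [← exp_add]; congr 1; ring
      have e2 : exp ((s - 1 / 2) * y₀) ≤ exp (-y₀ / 2) * exp (s * y i) := by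
        rw [← exp_add]
        apply exp_le_exp.2
        nlinarith [mul_le_mul_of_nonneg_left hle hs.1]
      rw [h, one_mul, e1, one_mul, div_le_iff₀ (by positivity)]
      linarith
  · intro i
    refine hdiag _ _ fun s hs => ?_
    simp only [hk, hz, Sum.elim_inr]
    rcases hχ i with h | h
    · simp [h]
    · have hle := hy i h
      have e1 : exp (-((1 - s) * y i) - (s - 1 / 2) * y₀ / 2) *
          exp (-((1 - s) * y i) - (s - 1 / 2) * y₀ / 2)
          = exp (-(2 * ((1 - s) * y i)) - (s - 1 / 2) * y₀) := by rw [← exp_add]; congr 1; ring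
      have e2 : exp (-(2 * ((1 - s) * y i)) - (s - 1 / 2) * y₀)
          ≤ exp (-y₀ / 2) * exp (-((1 - s) * y i)) := by
        rw [← exp_add]
        apply exp_le_exp.2
        nlinarith [mul_le_mul_of_nonneg_left hle (sub_nonneg.2 hs.2)]
      rw [h, one_mul, neg_mul_neg, e1, one_mul, div_le_iff₀ (by positivity)]
      linarith

end LogisticKernel

/-! ### Completing the full multiplier -/

section Multiplier

variable {n : ℕ}

theorem le_goldenRatio : (25 / 16 : ℝ) ≤ goldenRatio := by
  have : (2.2 : ℝ) ≤ √5 := Real.le_sqrt_of_sq_le (by norm_num)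
  rw [goldenRatio]; linarith

/-- With `q ≤ 1/2 + e`, the left side is at most `3/2 + e² / 4`; all is sharp at `e = 1/2`. -/
theorem add_sq_add_half_le {e q ρ : ℝ} (he : 0 < e) (he2 : e ≤ 1 / 2)
    (hqe : q ^ 2 * (1 - e) = e) (hρ : |ρ| ≤ (1 - e) / 2) :
    1 + ρ ^ 2 + q / 2 ≤ 25 / 16 := by
  have h1 : ρ ^ 2 ≤ ((1 - e) / 2) ^ 2 := sq_le_sq' (by linarith [abs_le.1 hρ]) (abs_le.1 hρ).2
  have h2 : q ≤ 1 / 2 + e := by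
    refine abs_le_of_sq_le_sq' ?_ (by linarith) |>.2
    have h3 : 0 ≤ 1 / 4 - e / 4 - e ^ 3 := by nlinarith [sq_nonneg e, mul_pos he he]
    refine le_of_mul_le_mul_right (a := 1 - e) ?_ (by linarith)
    rw [hqe]
    linarith
  nlinarith

/-- A positive semidefinite completion of the Schur multiplier `1 - logisticMean (y i) (y j)`,
whose entry at `(i₀, i₀)` is left free. -/
theorem exists_multiplier_completion (y : Fin n → ℝ) (i₀ : Fin n) {e : ℝ} (he : 0 < e)
    (he2 : e ≤ 1 / 2) (h₀ : (1 + exp (y i₀))⁻¹ ≤ 1 - e)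
    (h : ∀ j, j ≠ i₀ → (1 + exp (y j))⁻¹ ≤ e) :
    ∃ Z : Matrix (Fin n ⊕ Fin n) (Fin n ⊕ Fin n) ℂ, Z.PosSemidef ∧
      (∀ a, Z a a ≤ (goldenRatio : ℂ)) ∧
      ∀ i j, (i ≠ i₀ ∨ j ≠ i₀) → Z (.inl i) (.inr j) = ((1 - logisticMean (y i) (y j) : ℝ) : ℂ) := by
  have he1 : 0 < 1 - e := by linarith
  -- Logistic coordinate of `e`, so that `q = √(e / (1 - e))`.
  set y₀ := log ((1 - e) / e) with hy₀
  set q := exp (-y₀ / 2) with hq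
  set χ : Fin n → ℝ := fun i => if i = i₀ then 0 else 1 with hχ
  set ε : Fin n → ℝ := fun i => if i = i₀ then 1 else 0 with hε
  -- In row `i₀` the multiplier lies in `[e, 1]`. The product `x i * x j` supplies the midpoint `(1
  -- + e) / 2`, and `ρ` is the remaining error, of size at most `(1 - e) / 2`.
  set x : Fin n → ℝ := fun i => if i = i₀ then (1 + e) / 2 else 1 with hx
  set ρ : Fin n → ℝ := fun j =>
    if j = i₀ then 0 else 1 - logisticMean (y i₀) (y j) - (1 + e) / 2 with hρ
  have hqe : q ^ 2 * (1 - e) = e := by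
    rw [hq, ← exp_nat_mul, show ((2 : ℕ) : ℝ) * (-y₀ / 2) = -y₀ by push_cast; ring, Real.exp_neg,
      hy₀, exp_log (by positivity), inv_div, div_mul_cancel₀ _ he1.ne']
  have hρb : ∀ j, |ρ j| ≤ (1 - e) / 2 := by
    intro j
    by_cases hj : j = i₀
    · simp only [hρ, hj, if_true, abs_zero]; linarith
    · simp only [hρ, hj, if_false]
      have := logisticMean_nonneg (y i₀) (y j)
      have := logisticMean_le h₀ ((h j hj).trans (by linarith))
      rw [abs_le]; constructor <;> linarith
  have hyj : ∀ i, χ i = 1 → y₀ ≤ y i := by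
    intro i hi
    have hi' : i ≠ i₀ := by
      rintro rfl
      simp [hχ] at hi
    have := h i hi'
    rw [hy₀, log_le_iff_le_exp (by positivity), div_le_iff₀ he]
    rw [inv_le_iff_one_le_mul₀ (by positivity)] at this
    linarith
  obtain ⟨K, hK, hKo, hKl, hKr⟩ := exists_logisticMean_completion y χ y₀
    (fun i => by by_cases hi : i = i₀ <;> simp [hχ, hi]) hyj
  set w₁ : Fin n ⊕ Fin n → ℝ := Sum.elim x x with hw₁
  -- In the off-diagonal block `w₂` adds `ρ` to row `i₀` and `w₃` adds it to column `i₀`, at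
  -- diagonal cost `1` at `i₀` and `ρ²` elsewhere.
  set w₂ : Fin n ⊕ Fin n → ℝ := Sum.elim ε ρ with hw₂
  set w₃ : Fin n ⊕ Fin n → ℝ := Sum.elim ρ ε with hw₃
  have hb : ∀ i, x i * x i + (ε i * ε i + ρ i * ρ i) + χ i * (q / 2) ≤ goldenRatio := by
    intro i
    refine le_trans ?_ le_goldenRatio
    by_cases hi : i = i₀
    · simp only [hx, hε, hρ, hχ, hi, if_true]
      nlinarith
    · have := add_sq_add_half_le he he2 hqe (hρb i)
      simp only [hx, hε, hχ, hi, if_false]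
      linarith
  refine ⟨(of fun a b => ((w₁ a * w₁ b : ℝ) : ℂ)) + (of fun a b => ((w₂ a * w₂ b : ℝ) : ℂ)) +
    (of fun a b => ((w₃ a * w₃ b : ℝ) : ℂ)) + of fun a b => (K a b : ℂ),
    (((posSemidef_ofReal_mul w₁).add (posSemidef_ofReal_mul w₂)).add
      (posSemidef_ofReal_mul w₃)).add hK, ?_, ?_⟩
  · rintro (i | i) <;> simp only [add_apply, of_apply] <;> norm_cast <;>
      simp only [hw₁, hw₂, hw₃, Sum.elim_inl, Sum.elim_inr]
    · linarith [hb i, hKl i]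
    · linarith [hb i, hKr i]
  · intro i j hij
    simp only [add_apply, of_apply, hKo]
    norm_cast
    simp only [hw₁, hw₂, hw₃, Sum.elim_inl, Sum.elim_inr]
    by_cases hi : i = i₀ <;> by_cases hj : j = i₀
    · simp [hi, hj] at hij
    · simp only [hx, hε, hρ, hχ, hi, hj, if_true, if_false]; ring
    · simp only [hx, hε, hρ, hχ, hi, hj, if_true, if_false, logisticMean_comm (y i) (y i₀)]; ring
    · simp only [hx, hε, hρ, hχ, hi, hj, if_false]; ring

end Multiplier

end Matrix

/-! ### Commutators in an eigenbasis -/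

namespace Matrix

open Real

variable {n : ℕ}

theorem PosSemidef.traceNorm_hadamard_le {Z : Matrix (Fin n ⊕ Fin n) (Fin n ⊕ Fin n) ℂ} {α : ℝ}
    (hZ : Z.PosSemidef) (hd : ∀ a, Z a a ≤ α) (X : Matrix (Fin n) (Fin n) ℂ) :
    traceNorm (Z.toBlocks₁₂ ⊙ X) ≤ α * traceNorm X := by
  have e : fromBlocks Z.toBlocks₁₁ Z.toBlocks₁₂ Z.toBlocks₁₂ᴴ Z.toBlocks₂₂ = Z := by
    conv_rhs => rw [← fromBlocks_toBlocks Z]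
    congr 1
    ext i j
    exact congrFun (congrFun hZ.1 (.inr i)) (.inl j)
  exact Matrix.traceNorm_hadamard_le (e.symm ▸ hZ) (fun i => hd (.inl i)) (fun i => hd (.inr i)) X

theorem log_one_sub_div {c : ℝ} (h0 : 0 < c) (h1 : c < 1) :
    log ((1 - c) / c) = log (1 - c) - log c :=
  log_div (by linarith) h0.ne'

theorem one_add_exp_log_one_sub_div {c : ℝ} (h0 : 0 < c) (h1 : c < 1) :
    (1 + exp (log ((1 - c) / c)))⁻¹ = c := by
  rw [exp_log (div_pos (by linarith) h0)]
  field_simp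
  ring

theorem log_one_add_exp_neg_log_one_sub_div {c : ℝ} (h0 : 0 < c) (h1 : c < 1) :
    log (1 + exp (-log ((1 - c) / c))) = -log (1 - c) := by
  have : 0 < 1 - c := by linarith
  rw [Real.exp_neg, exp_log (div_pos this h0), inv_div, ← log_inv]
  congr 1
  field_simp
  ring

/-- Identifies the Schur multiplier that turns logit differences into logarithm differences. -/
theorem one_sub_logisticMean_mul {c d : ℝ} (hc : 0 < c) (hc1 : c < 1) (hd : 0 < d) (hd1 : d < 1) :
    (1 - logisticMean (log ((1 - c) / c)) (log ((1 - d) / d))) *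
      ((log d - log (1 - d)) - (log c - log (1 - c))) = log d - log c := by
  have h := sub_mul_logisticMean (log ((1 - c) / c)) (log ((1 - d) / d))
  rw [log_one_add_exp_neg_log_one_sub_div hc hc1, log_one_add_exp_neg_log_one_sub_div hd hd1,
    log_one_sub_div hc hc1, log_one_sub_div hd hd1] at h
  rw [log_one_sub_div hc hc1, log_one_sub_div hd hd1]
  linarith

/-- The commutator inequality in an eigenbasis. -/
theorem traceNorm_log_sub_log_le {c : Fin n → ℝ} (hc : ∀ i, 0 ≤ c i) (hsum : ∑ i, c i = 1)
    {B : Matrix (Fin n) (Fin n) ℂ} (hB : ∀ i j, c i ≠ 0 → c j = 0 → B i j = 0 ∧ B j i = 0) :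
    traceNorm (of fun i j => B i j * ((log (c j) - log (c i) : ℝ) : ℂ)) ≤
      goldenRatio * traceNorm (of fun i j => B i j *
        (((log (c j) - log (1 - c j)) - (log (c i) - log (1 - c i)) : ℝ) : ℂ)) := by
  have hne : Nonempty (Fin n) := by
    by_contra h
    rw [not_nonempty_iff] at h
    simp at hsum
  obtain ⟨i₀, -, hmax⟩ := Finset.exists_max_image Finset.univ c Finset.univ_nonempty
  have hpair : ∀ j, j ≠ i₀ → c i₀ + c j ≤ 1 := by
    intro j hj
    rw [← hsum, ← Finset.sum_pair hj.symm]
    exact Finset.sum_le_sum_of_subset_of_nonneg (Finset.subset_univ _) fun i _ _ => hc i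
  have hle : c i₀ ≤ 1 := hsum ▸ Finset.single_le_sum (fun i _ => hc i) (Finset.mem_univ i₀)
  have hpos : 0 < c i₀ := by
    by_contra h
    have : ∑ i, c i = 0 := Finset.sum_eq_zero fun i hi =>
      le_antisymm ((hmax i hi).trans (not_lt.1 h)) (hc i)
    linarith
  rcases hle.eq_or_lt with h1 | h1
  -- If the top eigenvalue is `1`, the others vanish, and the convention `log 0 = 0` makes the left
  -- side zero.
  · have hlog : ∀ i, log (c i) = 0 := by
      intro i
      by_cases hi : i = i₀
      · rw [hi, h1, log_one]
      · have : c i = 0 := le_antisymm (by linarith [hpair i hi]) (hc i)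
        rw [this, log_zero]
    have : (of fun i j => B i j * ((log (c j) - log (c i) : ℝ) : ℂ)) = 0 := by
      ext i j
      simp [hlog]
    rw [this, traceNorm_zero]
    exact mul_nonneg goldenRatio_pos.le (traceNorm_nonneg _)
  set e := min (1 - c i₀) (1 / 2) with he
  have he0 : 0 < e := lt_min (by linarith) (by norm_num)
  have he2 : e ≤ 1 / 2 := min_le_right _ _
  have hce : ∀ j, j ≠ i₀ → c j ≤ e := fun j hj =>
    le_min (by linarith [hpair j hj]) (by linarith [hpair j hj, hmax j (Finset.mem_univ j)])
  -- Zero eigenvalues have no logistic coordinate. Any value in `(0, e]` may replace them, since the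
  -- matrix entries they touch vanish on both sides.
  set d : Fin n → ℝ := fun i => if c i = 0 then e else c i with hd
  have hd0 : ∀ i, 0 < d i := by
    intro i
    by_cases h : c i = 0
    · simpa [hd, h] using he0
    · simpa [hd, h] using lt_of_le_of_ne (hc i) (Ne.symm h)
  have hdi₀ : d i₀ = c i₀ := by simp [hd, hpos.ne']
  have hde : ∀ j, j ≠ i₀ → d j ≤ e := by
    intro j hj
    by_cases h : c j = 0
    · simp [hd, h]
    · simpa [hd, h] using hce j hj
  have hd1 : ∀ i, d i < 1 := by
    intro i
    by_cases hi : i = i₀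
    · rwa [hi, hdi₀]
    · linarith [hde i hi]
  obtain ⟨Z, hZ, hZd, hZo⟩ := exists_multiplier_completion (fun i => log ((1 - d i) / d i)) i₀
    he0 he2 (by
      rw [one_add_exp_log_one_sub_div (hd0 _) (hd1 _), hdi₀]
      linarith [min_le_left (1 - c i₀) (1 / 2)])
    (fun j hj => by rw [one_add_exp_log_one_sub_div (hd0 _) (hd1 _)]; exact hde j hj)
  convert hZ.traceNorm_hadamard_le hZd _ using 2
  ext i j
  simp only [hadamard_apply, of_apply, toBlocks₁₂]
  by_cases hij : i = j
  · simp [hij]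
  have hij' : i ≠ i₀ ∨ j ≠ i₀ := by
    by_contra h
    push Not at h
    exact hij (h.1.trans h.2.symm)
  rw [hZo i j hij']
  by_cases hi : c i = 0 <;> by_cases hj : c j = 0
  · simp [hi, hj]
  · simp [(hB j i hj hi).2]
  · simp [(hB i j hi hj).1]
  · have hdi : d i = c i := by simp [hd, hi]
    have hdj : d j = c j := by simp [hd, hj]
    rw [← hdi, ← hdj, ← one_sub_logisticMean_mul (hd0 i) (hd1 i) (hd0 j) (hd1 j)]
    push_cast
    ring

/-- Commutators with functions of a Hermitian matrix in an eigenbasis. -/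
theorem IsHermitian.commutator_cfc {C : Matrix (Fin n) (Fin n) ℂ} (hC : C.IsHermitian)
    (A : Matrix (Fin n) (Fin n) ℂ) (f : ℝ → ℝ) :
    ⁅A, cfc f C⁆ = (hC.eigenvectorUnitary : Matrix (Fin n) (Fin n) ℂ) *
      (of fun i j => ((hC.eigenvectorUnitary : Matrix (Fin n) (Fin n) ℂ)ᴴ * A *
        (hC.eigenvectorUnitary : Matrix (Fin n) (Fin n) ℂ)) i j *
        ((f (hC.eigenvalues j) - f (hC.eigenvalues i) : ℝ) : ℂ)) *
      (hC.eigenvectorUnitary : Matrix (Fin n) (Fin n) ℂ)ᴴ := by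
  set U := (hC.eigenvectorUnitary : Matrix (Fin n) (Fin n) ℂ) with hU
  have hUU : U * Uᴴ = 1 := Unitary.coe_mul_star_self hC.eigenvectorUnitary
  set D : Matrix (Fin n) (Fin n) ℂ := diagonal fun i => ((f (hC.eigenvalues i) : ℝ) : ℂ) with hD
  have hcfc : cfc f C = U * D * Uᴴ := by
    rw [hC.cfc_eq, IsHermitian.cfc, Unitary.conjStarAlgAut_apply]
    rfl
  have hof : (of fun i j => (Uᴴ * A * U) i j *
      ((f (hC.eigenvalues j) - f (hC.eigenvalues i) : ℝ) : ℂ))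
      = Uᴴ * A * U * D - D * (Uᴴ * A * U) := by
    ext i j
    rw [sub_apply, hD, mul_diagonal, diagonal_mul, of_apply]
    push_cast
    ring
  rw [hof, hcfc, Ring.lie_def, Matrix.mul_sub, Matrix.sub_mul]
  congr 1
  · calc A * (U * D * Uᴴ) = 1 * A * (U * D * Uᴴ) := by rw [Matrix.one_mul]
      _ = _ := by rw [← hUU]; simp only [Matrix.mul_assoc]
  · calc U * D * Uᴴ * A = U * D * Uᴴ * A * 1 := by rw [Matrix.mul_one]
      _ = _ := by rw [← hUU]; simp only [Matrix.mul_assoc]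

theorem IsHermitian.traceNorm_commutator_cfc {C : Matrix (Fin n) (Fin n) ℂ} (hC : C.IsHermitian)
    (A : Matrix (Fin n) (Fin n) ℂ) (f : ℝ → ℝ) :
    traceNorm ⁅A, cfc f C⁆ =
      traceNorm (of fun i j => ((hC.eigenvectorUnitary : Matrix (Fin n) (Fin n) ℂ)ᴴ * A *
        (hC.eigenvectorUnitary : Matrix (Fin n) (Fin n) ℂ)) i j *
        ((f (hC.eigenvalues j) - f (hC.eigenvalues i) : ℝ) : ℂ)) := by
  rw [hC.commutator_cfc]
  exact traceNorm_conj (Unitary.coe_star_mul_self hC.eigenvectorUnitary) _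

theorem IsHermitian.entry_mul_eq_zero_of_commute {C : Matrix (Fin n) (Fin n) ℂ}
    (hC : C.IsHermitian) {A : Matrix (Fin n) (Fin n) ℂ} {f : ℝ → ℝ} (h : Commute A (cfc f C))
    (i j : Fin n) :
    ((hC.eigenvectorUnitary : Matrix (Fin n) (Fin n) ℂ)ᴴ * A *
        (hC.eigenvectorUnitary : Matrix (Fin n) (Fin n) ℂ)) i j *
        ((f (hC.eigenvalues j) - f (hC.eigenvalues i) : ℝ) : ℂ) = 0 := by
  have h0 : ⁅A, cfc f C⁆ = 0 := h.lie_eq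
  rw [hC.commutator_cfc] at h0
  set U := (hC.eigenvectorUnitary : Matrix (Fin n) (Fin n) ℂ) with hU
  have hUU : Uᴴ * U = 1 := Unitary.coe_star_mul_self hC.eigenvectorUnitary
  set R := (of fun i j => (Uᴴ * A * U) i j *
      ((f (hC.eigenvalues j) - f (hC.eigenvalues i) : ℝ) : ℂ)) with hR
  have : R = 0 := by
    calc R = Uᴴ * U * R * (Uᴴ * U) := by rw [hUU, Matrix.one_mul, Matrix.mul_one]
      _ = Uᴴ * (U * R * Uᴴ) * U := by simp only [Matrix.mul_assoc]
      _ = 0 := by rw [h0, Matrix.mul_zero, Matrix.zero_mul]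
  exact congrFun (congrFun this i) j

theorem IsHermitian.sum_eigenvalues_eq_one {C : Matrix (Fin n) (Fin n) ℂ} (hC : C.IsHermitian)
    (htr : C.trace = 1) : ∑ i, hC.eigenvalues i = 1 := by
  have h := congrArg Complex.re hC.trace_eq_sum_eigenvalues
  rw [htr] at h
  simpa using h.symm

theorem PosSemidef.traceNorm_commutator_log_le {A C : Matrix (Fin n) (Fin n) ℂ}
    (hC : C.PosSemidef) (htr : C.trace = 1) (hA : Commute A (spectralProj C {x | x ≤ 0})) :
    traceNorm ⁅A, cfc log C⁆ ≤
      goldenRatio * traceNorm ⁅A, cfc (fun x => log x - log (1 - x)) C⁆ := by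
  rw [hC.1.traceNorm_commutator_cfc, hC.1.traceNorm_commutator_cfc]
  refine traceNorm_log_sub_log_le hC.eigenvalues_nonneg
    (hC.1.sum_eigenvalues_eq_one htr) fun i j hi hj => ?_
  · have hi' : ¬ hC.1.eigenvalues i ≤ 0 := fun h => hi (le_antisymm h (hC.eigenvalues_nonneg i))
    have h1 := hC.1.entry_mul_eq_zero_of_commute hA i j
    have h2 := hC.1.entry_mul_eq_zero_of_commute hA j i
    simp only [Set.indicator_apply, Set.mem_ofPred_eq, hj, hi', le_refl, if_true, if_false] at h1 h2
    exact ⟨by simpa using h1, by simpa using h2⟩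

end Matrix

/-! ### Extended-valued logarithm and logit -/

section ExtendedLog

open Matrix

theorem extLog_of_nonpos {x : ℝ} (hx : x ≤ 0) : extLog x = ⊥ := by
  rw [extLog, ENNReal.ofReal_of_nonpos hx, ENNReal.log_zero]

theorem extLog_of_pos {x : ℝ} (hx : 0 < x) : extLog x = (Real.log x : EReal) := by
  rw [extLog, ENNReal.log_ofReal_of_pos hx]

theorem setOf_extLog_eq_bot : {x | extLog x = ⊥} = {x | x ≤ 0} := by
  ext x
  refine ⟨fun h => ?_, extLog_of_nonpos⟩
  by_contra hx
  rw [Set.mem_ofPred_eq, not_le] at hx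
  exact EReal.coe_ne_bot _ ((extLog_of_pos hx).symm.trans h)

theorem setOf_extLog_eq_top : {x | extLog x = ⊤} = ∅ := by
  refine Set.eq_empty_of_forall_notMem fun x h => ?_
  rw [Set.mem_ofPred_eq] at h
  rcases le_or_gt x 0 with hx | hx
  · rw [extLog_of_nonpos hx] at h
    exact bot_ne_top h
  · rw [extLog_of_pos hx] at h
    exact EReal.coe_ne_top _ h

theorem setOf_extLogit_eq_bot : {x | extLogit x = ⊥} = {x | x ≤ 0} := by
  ext x
  refine ⟨fun h => ?_, fun h => ?_⟩
  · by_contra hx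
    rw [Set.mem_ofPred_eq, not_le] at hx
    rw [Set.mem_ofPred_eq, extLogit, extLog_of_pos hx] at h
    rcases le_or_gt (1 - x) 0 with h1 | h1
    · rw [extLog_of_nonpos h1, EReal.coe_sub_bot] at h
      exact top_ne_bot h
    · rw [extLog_of_pos h1, ← EReal.coe_sub] at h
      exact EReal.coe_ne_bot _ h
  · rw [Set.mem_ofPred_eq, extLogit, extLog_of_nonpos h, EReal.bot_sub]

theorem toReal_extLog {x : ℝ} (hx : 0 ≤ x) : (extLog x).toReal = Real.log x := by
  rcases hx.eq_or_lt with rfl | hx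
  · rw [extLog_of_nonpos le_rfl, EReal.toReal_bot, Real.log_zero]
  · rw [extLog_of_pos hx, EReal.toReal_coe]

theorem toReal_extLogit {x : ℝ} (h0 : 0 ≤ x) (h1 : x ≤ 1) :
    (extLogit x).toReal = Real.log x - Real.log (1 - x) := by
  rw [extLogit]
  rcases h0.eq_or_lt with rfl | h0
  · simp [extLog_of_nonpos le_rfl]
  rcases h1.eq_or_lt with rfl | h1
  · simp [extLog_of_nonpos le_rfl, extLog_of_pos]
  · rw [extLog_of_pos h0, extLog_of_pos (sub_pos.2 h1), ← EReal.coe_sub, EReal.toReal_coe]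

end ExtendedLog

/-! ### Spectrum of `C` and the final inequality -/

theorem Matrix.PosSemidef.mem_Icc_of_mem_spectrum {n : ℕ} {C : Matrix (Fin n) (Fin n) ℂ}
    (hC : C.PosSemidef) (htr : C.trace = 1) {x : ℝ} (hx : x ∈ spectrum ℝ C) :
    x ∈ Set.Icc (0 : ℝ) 1 := by
  rw [hC.1.spectrum_real_eq_range_eigenvalues] at hx
  obtain ⟨i, rfl⟩ := hx
  exact ⟨hC.eigenvalues_nonneg i,
    hC.1.sum_eigenvalues_eq_one htr ▸ Finset.single_le_sum (fun i _ => hC.eigenvalues_nonneg i) (Finset.mem_univ i)⟩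

theorem Matrix.IsHermitian.matrixLog_sub_matrixLog {n : ℕ} {C : Matrix (Fin n) (Fin n) ℂ}
    (hC : C.IsHermitian) :
    matrixLog C - matrixLog (1 - C) = cfc (fun x => Real.log x - Real.log (1 - x)) C := by
  have hfin : ∀ f : ℝ → ℝ, ContinuousOn f (spectrum ℝ C) :=
    fun f => C.finite_real_spectrum.continuousOn f
  have h1 : cfc (fun x : ℝ => 1 - x) C = 1 - C := by
    refine (cfc_sub (fun _ => (1 : ℝ)) (fun x => x) C (hfin _) (hfin _)).trans ?_
    exact congrArg₂ _ (cfc_const_one ℝ C hC) (cfc_id_of_isHermitian hC)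
  have h2 : cfc (fun x : ℝ => Real.log (1 - x)) C = cfc Real.log (cfc (fun x : ℝ => 1 - x) C) :=
    cfc_comp' Real.log (fun x => 1 - x) C ((C.finite_real_spectrum.image _).continuousOn _)
      (hfin _) hC
  rw [matrixLog, matrixLog, ← h1, ← h2]
  exact (cfc_sub Real.log (fun x => Real.log (1 - x)) C (hfin _) (hfin _)).symm

theorem mainTheorem8 (n : ℕ) (A C : Matrix (Fin n) (Fin n) ℂ)
    (hC : C.PosSemidef) (htr : C.trace = 1) :
    (C.PosDef →
      traceNorm ⁅A, matrixLog C⁆ ≤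
        Real.goldenRatio * traceNorm ⁅A, matrixLog C - matrixLog (1 - C)⁆) ∧
    commTraceNorm A extLog C ≤
      ENNReal.ofReal Real.goldenRatio * commTraceNorm A extLogit C := by
  refine ⟨fun hpd => ?_, ?_⟩
  · rw [hC.1.matrixLog_sub_matrixLog]
    refine hC.traceNorm_commutator_log_le htr ?_
    have : spectralProj C {x | x ≤ 0} = 0 := by
      rw [spectralProj, ← cfc_const_zero ℝ C]
      refine cfc_congr fun x hx => Set.indicator_of_notMem ?_ _
      rw [hC.1.spectrum_real_eq_range_eigenvalues] at hx
      obtain ⟨i, rfl⟩ := hx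
      exact not_le.2 (hpd.eigenvalues_pos i)
    rw [this]
    exact Commute.zero_right A
  · have hlog : cfc (fun x => (extLog x).toReal) C = cfc Real.log C :=
      cfc_congr fun x hx => toReal_extLog (hC.mem_Icc_of_mem_spectrum htr hx).1
    have hlogit : cfc (fun x => (extLogit x).toReal) C
        = cfc (fun x => Real.log x - Real.log (1 - x)) C :=
      cfc_congr fun x hx => toReal_extLogit (hC.mem_Icc_of_mem_spectrum htr hx).1
        (hC.mem_Icc_of_mem_spectrum htr hx).2
    have hempty : spectralProj C ∅ = 0 := by simp [spectralProj]
    rw [commTraceNorm, commTraceNorm, setOf_extLog_eq_bot, setOf_extLog_eq_top,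
      setOf_extLogit_eq_bot, hempty, hlog, hlogit]
    -- Both functions are `-∞` exactly on `x ≤ 0` and the logarithm is never `+∞`, so a finite right
    -- side forces a finite left side.
    split_ifs with h1 h2 h2
    · rw [← ENNReal.ofReal_mul Real.goldenRatio_pos.le]
      exact ENNReal.ofReal_le_ofReal (hC.traceNorm_commutator_log_le htr h1.1)
    · rw [ENNReal.mul_top (by simpa using Real.goldenRatio_pos)]
      exact le_top
    · exact absurd ⟨h2.1, Commute.zero_right A⟩ h1
    · rw [ENNReal.mul_top (by simpa using Real.goldenRatio_pos)]
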